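/- Let $L\ge 3$ and let $N_1,\dots,N_L$ be dimensions. For a tensor $\mathcal A\in\mathbb H^{N_1\times N_2\times N_3\times\cdots\times N_L}$ over the quaternions $\mathbb H$ and $M\in\mathbb H^{N_n\times N_n}$, the mode product $\mathcal A\times_n M$ multiplies the mode-$n$ unfolding of $\mathcal A$ from the left by $M$. Let $T_n\in\mathbb H^{N_n\times N_n}$ ($n=3,\dots,L$) be invertible matrices and put $\widehat{\mathcal A}=\mathcal A\times_3T_3\times_4\cdots\times_LT_L$ (mode $3$ first). The inverse of $\mathcal A\mapsto\widehat{\mathcal A}$ is $\mathcal B\mapsto\mathcal B\times_LT_L^{-1}\times\cdots\times_3T_3^{-1}$ (mode $L$ first). The product $\mathcal A\star_{QT}\mathcal B$ is the tensor $\mathcal C$ such that each frontal slice of $\widehat{\mathcal C}$ is the matrix product of the corresponding frontal slices of $\widehat{\mathcal A}$ and $\widehat{\mathcal B}$. The conjugate transpose $\mathcal A^H$ is the tensor for which each frontal slice of $\widehat{\mathcal A^H}$ is the conjugate transpose of the corresponding frontal slice of $\widehat{\mathcal A}$. The identity tensor $\mathcal I$ is the tensor for which all frontal slices of $\widehat{\mathcal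 I}$ are identity matrices, and $\mathcal U$ is unitary if $\mathcal U^H\star_{QT}\mathcal U=\mathcal I=\mathcal U\star_{QT}\mathcal U^H$. A TQt-SVD of $\mathcal A\in\mathbb H^{N_1\times\cdots\times N_L}$ is a factorization $\mathcal A=\mathcal U\star_{QT}\mathcal D\star_{QT}\mathcal V^H$ with unitary tensors $\mathcal U\in\mathbb H^{N_1\times N_1\times N_3\times\cdots\times N_L}$ and $\mathcal V\in\mathbb H^{N_2\times N_2\times N_3\times\cdots\times N_L}$, and with $\mathcal D\in\mathbb H^{N_1\times\cdots\times N_L}$ f-diagonal (its entries lie on the diagonals of its frontal slices), such that in each frontal slice of $\widehat{\mathcal D}$ the diagonal entries are real, nonnegative and nonincreasing. The tensor $\mathcal A$ has TQt-rank $r$ if it has a TQt-SVD in which exactly $r$ of the tubes $\mathcal D(k,k,:,\dots,:)$, $1\le k\le\min(N_1,N_2)$, are nonzero. **Theorem.** Suppose that $T_n=c_nU_n$ for $n=3,\dots,L$, with nonzero real numbers $c_n$ and unitary matrices $U_n\in\mathbb H^{N_n\times N_n}$. Let $\mathcal A=\mathcal U\star_{QT}\mathcal D\star_{QT}\mathcal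 V^H$ be a TQt-SVD of $\mathcal A\in\mathbb H^{N_1\times\cdots\times N_L}$, let $r$ be the TQt-rank of $\mathcal A$, let $0\le s\le r$, and put $$\mathcal A_s=\sum_{k=1}^{s}\mathcal U(:,k,:,\dots,:)\star_{QT}\mathcal D(k,k,:,\dots,:)\star_{QT}\mathcal V(:,k,:,\dots,:)^H .$$ Then $\mathcal A_s$ has TQt-rank $s$, and it minimizes $\|\mathcal A-\mathcal G\|_F$ over all $\mathcal G\in\mathbb H^{N_1\times\cdots\times N_L}$ of TQt-rank $s$. Moreover, $$\|\mathcal A-\mathcal A_s\|_F^2=\sum_{k=s+1}^{r}\|\mathcal D(k,k,:,\dots,:)\|_F^2 .$$ -/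

import Mathlib

namespace QuatTensor

/-- Quaternion tensors of order `L = d + 2` and size `n₁ × n₂ × N 0 × ⋯ × N (d - 1)`.
The `i`-th entry of `N` is the size of mode `i + 3`. -/
abbrev QTensor {d : ℕ} (n₁ n₂ : ℕ) (N : Fin d → ℕ) : Type :=
  Fin n₁ → Fin n₂ → ((i : Fin d) → Fin (N i)) → Quaternion ℝ

/-- Square invertible quaternion matrices, one for each mode from the third on. -/
abbrev Transforms {d : ℕ} (N : Fin d → ℕ) : Type :=
  (i : Fin d) → (Matrix (Fin (N i)) (Fin (N i)) (Quaternion ℝ))ˣ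

section

variable {d : ℕ} {N : Fin d → ℕ} {n₁ n₂ p : ℕ}

/-- The frontal slice `A(:,:,n₃,…,n_L)`. -/
def slice (A : QTensor n₁ n₂ N) (n : (i : Fin d) → Fin (N i)) :
    Matrix (Fin n₁) (Fin n₂) (Quaternion ℝ) :=
  Matrix.of fun a b => A a b n

/-- The tensor with prescribed frontal slices. -/
def ofSlices (S : ((i : Fin d) → Fin (N i)) → Matrix (Fin n₁) (Fin n₂) (Quaternion ℝ)) :
    QTensor n₁ n₂ N :=
  fun a b n => S n a b

/-- The Frobenius norm. -/
noncomputable def frobNorm (A : QTensor n₁ n₂ N) : ℝ :=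
  Real.sqrt (∑ a, ∑ b, ∑ n, ‖A a b n‖ ^ 2)

/-- The mode product `A ×ᵢ M` along one of the modes from the third on: the corresponding
unfolding of `A` is multiplied by `M` from the left. -/
noncomputable def modeProd (i : Fin d) (M : Matrix (Fin (N i)) (Fin (N i)) (Quaternion ℝ))
    (A : QTensor n₁ n₂ N) : QTensor n₁ n₂ N :=
  fun a b n => ∑ m : Fin (N i), M (n i) m * A a b (Function.update n i m)

/-- `Â = A ×₃ T₃ ×₄ ⋯ ×_L T_L`, the third mode being transformed first. -/
noncomputable def transform (T : Transforms N) (A : QTensor n₁ n₂ N) : QTensor n₁ n₂ N :=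
  (List.finRange d).foldl (fun B i => modeProd i (T i).val B) A

/-- The inverse of `transform`. Mode products of quaternion tensors along different modes need
not commute, so the inverse matrices are applied in the reverse order, the last mode first. -/
noncomputable def invTransform (T : Transforms N) (A : QTensor n₁ n₂ N) : QTensor n₁ n₂ N :=
  (List.finRange d).foldr (fun i B => modeProd i ((T i)⁻¹).val B) A

/-- The facewise product. -/
noncomputable def faceProd (A : QTensor n₁ p N) (B : QTensor p n₂ N) : QTensor n₁ n₂ N :=
  ofSlices fun n => slice A n * slice B n

/-- The transform-based product `A ⋆ B`. -/
noncomputable def qtProd (T : Transforms N) (A : QTensor n₁ p N) (B : QTensor p n₂ N) :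
    QTensor n₁ n₂ N :=
  invTransform T (faceProd (transform T A) (transform T B))

/-- The conjugate transpose `Aᴴ`: in the transform domain, each frontal slice is conjugate
transposed. -/
noncomputable def conjT (T : Transforms N) (A : QTensor n₁ n₂ N) : QTensor n₂ n₁ N :=
  invTransform T (ofSlices fun n => (slice (transform T A) n).conjTranspose)

/-- The identity tensor: in the transform domain, each frontal slice is the identity matrix. -/
noncomputable def identity (T : Transforms N) (p : ℕ) : QTensor p p N :=
  invTransform T (ofSlices fun _ => 1)

/-- Unitary quaternion tensors. -/
def IsUnitary (T : Transforms N) (U : QTensor p p N) : Prop :=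
  qtProd T (conjT T U) U = identity T p ∧ qtProd T U (conjT T U) = identity T p

/-- f-diagonal tensors: the entries lie on the diagonals of the frontal slices. -/
def IsFDiagonal (D : QTensor n₁ n₂ N) : Prop :=
  ∀ a b, a.val ≠ b.val → ∀ n, D a b n = 0

/-- The tube `D(k,k,:,…,:)` as a `1 × 1 × N₃ × ⋯ × N_L` tensor. -/
def tube (D : QTensor n₁ n₂ N) (k : Fin (min n₁ n₂)) : QTensor 1 1 N :=
  fun _ _ n => D (Fin.castLE (min_le_left n₁ n₂) k) (Fin.castLE (min_le_right n₁ n₂) k) n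

/-- The lateral slice `U(:,k,:,…,:)` as an `n₁ × 1 × N₃ × ⋯ × N_L` tensor. -/
def lateral (U : QTensor n₁ n₂ N) (k : Fin n₂) : QTensor n₁ 1 N :=
  fun a _ n => U a k n

/-- `A = U ⋆ D ⋆ Vᴴ` is a TQt-SVD: `U` and `V` are unitary, `D` is f-diagonal, and in the
transform domain each frontal slice is a quaternion matrix singular value decomposition, so that
the diagonal entries of the slices of `D̂` are real, nonnegative and nonincreasing. -/
structure IsTQtSVD (T : Transforms N) (A : QTensor n₁ n₂ N)
    (U : QTensor n₁ n₁ N) (D : QTensor n₁ n₂ N) (V : QTensor n₂ n₂ N) : Prop where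
  unitary_left : IsUnitary T U
  unitary_right : IsUnitary T V
  fdiagonal : IsFDiagonal D
  singularValues : ∃ σ : ((i : Fin d) → Fin (N i)) → Fin (min n₁ n₂) → ℝ,
    (∀ n k, 0 ≤ σ n k) ∧ (∀ n, Antitone (σ n)) ∧
    ∀ n k, transform T D (Fin.castLE (min_le_left n₁ n₂) k)
      (Fin.castLE (min_le_right n₁ n₂) k) n = ((σ n k : ℝ) : Quaternion ℝ)
  eq_prod : A = qtProd T (qtProd T U D) (conjT T V)

/-- The number of nonzero tubes `D(k,k,:,…,:)`. -/
noncomputable def numNonzeroTubes (D : QTensor n₁ n₂ N) : ℕ :=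
  Set.ncard {k : Fin (min n₁ n₂) | 0 < frobNorm (tube D k)}

/-- `A` has TQt-rank `r`: the f-diagonal factor in a TQt-SVD of `A` has `r` nonzero tubes. -/
def HasTQtRank (T : Transforms N) (A : QTensor n₁ n₂ N) (r : ℕ) : Prop :=
  ∃ (U : QTensor n₁ n₁ N) (D : QTensor n₁ n₂ N) (V : QTensor n₂ n₂ N),
    IsTQtSVD T A U D V ∧ numNonzeroTubes D = r

/-- The truncated sum `∑_{k ≤ s} U(:,k,…) ⋆ D(k,k,…) ⋆ V(:,k,…)ᴴ` (indices `k` start at `0`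
here). -/
noncomputable def truncation (T : Transforms N) (U : QTensor n₁ n₁ N) (D : QTensor n₁ n₂ N)
    (V : QTensor n₂ n₂ N) (s : ℕ) : QTensor n₁ n₂ N :=
  ∑ k : Fin (min n₁ n₂) with k.val < s,
    qtProd T (qtProd T (lateral U (Fin.castLE (min_le_left n₁ n₂) k)) (tube D k))
      (conjT T (lateral V (Fin.castLE (min_le_right n₁ n₂) k)))

end

end QuatTensor

open QuatTensor

/-! Each mode product with a scaled unitary matrix multiplies the squared Frobenius norm by `c i ^
2` (`sum_norm_sq_modeProd`), so the whole transform scales it by a fixed positive factor. In the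
transform domain the problem splits into one quaternion matrix problem per frontal slice.

The slices share one rank bound. The transform acts tube by tube and is injective, so a tube of `D`
is nonzero iff some slice has a positive singular value there. By monotonicity the nonzero tubes
come first (`HasSingularValues.tube_pos_iff_lt`). A competitor with `s` nonzero tubes thus has, in
every slice, a diagonal factor whose rows from `s` on vanish. The matrix Eckart–Young bound
`sum_sq_le_sqNorm_sub` applies in each slice, and the truncation attains it in all slices at once.

The matrix bound needs neither eigenvalues nor a min-max principle: unitary rotations reduce it to a
weighted sum of squared singular values, estimated by `sum_sq_le_weighted_sum`. Applied with a
second TQt-SVD of `A` itself as competitor, it also shows that the number of nonzero tubes depends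
only on `A`. -/

namespace QuatTensor

open Matrix

/-! ### The squared Frobenius norm of a quaternion matrix -/

section Matrices

lemma coe_norm_sq (q : Quaternion ℝ) : ((‖q‖ ^ 2 : ℝ) : Quaternion ℝ) = star q * q := by
  rw [Quaternion.star_mul_self, Quaternion.normSq_eq_norm_mul_self, sq]

lemma coe_sum_real {α : Type*} (s : Finset α) (f : α → ℝ) :
    ((∑ i ∈ s, f i : ℝ) : Quaternion ℝ) = ∑ i ∈ s, (f i : Quaternion ℝ) :=
  map_sum (algebraMap ℝ (Quaternion ℝ)) f s

lemma sum_comp_le_sum {α β : Type*} [Fintype α] [Fintype β] {e : α → β}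
    (he : Function.Injective e) {f : β → ℝ} (hf : ∀ b, 0 ≤ f b) : ∑ a, f (e a) ≤ ∑ b, f b := by
  classical
  rw [← Finset.sum_image (f := f) he.injOn]
  exact Finset.sum_le_sum_of_subset_of_nonneg (Finset.subset_univ _) fun _ _ _ => hf _

variable {ι κ μ : Type*} [Fintype ι] [Fintype κ] [Fintype μ]

/-- The squared Frobenius norm of a quaternion matrix. -/
noncomputable def sqNorm (M : Matrix ι κ (Quaternion ℝ)) : ℝ := ∑ i, ∑ j, ‖M i j‖ ^ 2

lemma coe_sqNorm (M : Matrix ι κ (Quaternion ℝ)) :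
    (sqNorm M : Quaternion ℝ) = trace (Mᴴ * M) := by
  rw [sqNorm, Finset.sum_comm, coe_sum_real]
  simp only [trace, diag_apply, mul_apply, conjTranspose_apply, coe_sum_real, coe_norm_sq]

lemma sqNorm_conjTranspose (M : Matrix ι κ (Quaternion ℝ)) : sqNorm Mᴴ = sqNorm M := by
  simp only [sqNorm, conjTranspose_apply, norm_star]
  exact Finset.sum_comm

lemma sqNorm_mul_left [DecidableEq ι] {R : Matrix μ ι (Quaternion ℝ)} (hR : Rᴴ * R = 1)
    (M : Matrix ι κ (Quaternion ℝ)) : sqNorm (R * M) = sqNorm M := by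
  apply Quaternion.coe_injective
  rw [coe_sqNorm, coe_sqNorm, conjTranspose_mul, Matrix.mul_assoc, ← Matrix.mul_assoc Rᴴ, hR,
    Matrix.one_mul]

/-- The trace is not cyclic over the quaternions, so the Gram matrix argument for left factors does
not transfer directly; conjugate transposition moves the factor to the left. -/
lemma sqNorm_mul_right [DecidableEq κ] {R : Matrix κ μ (Quaternion ℝ)} (hR : R * Rᴴ = 1)
    (M : Matrix ι κ (Quaternion ℝ)) : sqNorm (M * R) = sqNorm M := by
  rw [← sqNorm_conjTranspose, conjTranspose_mul, sqNorm_mul_left (by simpa using hR),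
    sqNorm_conjTranspose]

lemma sqNorm_smul (c : ℝ) (M : Matrix ι κ (Quaternion ℝ)) :
    sqNorm (c • M) = c ^ 2 * sqNorm M := by
  simp only [sqNorm, Matrix.smul_apply, norm_smul, mul_pow, Finset.mul_sum, Real.norm_eq_abs,
    sq_abs]

lemma sum_col_norm_sq [DecidableEq ι] {R : Matrix ι ι (Quaternion ℝ)} (hR : Rᴴ * R = 1) (j : ι) :
    ∑ i, ‖R i j‖ ^ 2 = 1 := by
  apply Quaternion.coe_injective
  have h := congrFun (congrFun hR j) j
  rw [mul_apply, one_apply_eq] at h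
  simpa only [coe_sum_real, coe_norm_sq, conjTranspose_apply, Quaternion.coe_one] using h

lemma sum_row_norm_sq [DecidableEq ι] {R : Matrix ι ι (Quaternion ℝ)} (hR : R * Rᴴ = 1) (i : ι) :
    ∑ j, ‖R i j‖ ^ 2 = 1 := by
  simpa using sum_col_norm_sq (R := Rᴴ) (by simpa using hR) i

end Matrices

/-! ### Rectangular diagonal matrices -/

section Diagonal

variable {n₁ n₂ : ℕ}

/-- The row index of the `k`-th diagonal entry. -/
abbrev rowIdx (k : Fin (min n₁ n₂)) : Fin n₁ := Fin.castLE (min_le_left n₁ n₂) k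

/-- The column index of the `k`-th diagonal entry. -/
abbrev colIdx (k : Fin (min n₁ n₂)) : Fin n₂ := Fin.castLE (min_le_right n₁ n₂) k

lemma sum_sum_eq_sum_diag {E : Type*} [AddCommMonoid E] (f : Fin n₁ → Fin n₂ → E)
    (hf : ∀ i j, i.val ≠ j.val → f i j = 0) :
    ∑ i, ∑ j, f i j = ∑ k : Fin (min n₁ n₂), f (rowIdx k) (colIdx k) := by
  rw [← Fintype.sum_prod_type' f]
  symm
  refine Finset.sum_of_injOn (fun k => (rowIdx k, colIdx k)) ?_ (by simp) ?_ (by simp)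
  · intro k _ l _ h
    simpa [Fin.ext_iff] using h
  · rintro ⟨i, j⟩ _ h
    by_contra hne
    have hij : i.val = j.val := by
      by_contra h'
      exact hne (hf i j h')
    exact h ⟨⟨i.val, lt_min i.2 (hij ▸ j.2)⟩, by simp, by simp [Fin.ext_iff, hij]⟩

/-- The matrix `S` is diagonal with the real diagonal entries `σ`. -/
def IsRealDiag (S : Matrix (Fin n₁) (Fin n₂) (Quaternion ℝ)) (σ : Fin (min n₁ n₂) → ℝ) : Prop :=
  (∀ i j, i.val ≠ j.val → S i j = 0) ∧ ∀ k, S (rowIdx k) (colIdx k) = ((σ k : ℝ) : Quaternion ℝ)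

namespace IsRealDiag

variable {S : Matrix (Fin n₁) (Fin n₂) (Quaternion ℝ)} {σ : Fin (min n₁ n₂) → ℝ}

lemma sqNorm_eq (hS : IsRealDiag S σ) : sqNorm S = ∑ k, σ k ^ 2 := by
  rw [sqNorm, sum_sum_eq_sum_diag _ fun i j h => by simp [hS.1 i j h]]
  simp [hS.2]

lemma mul_apply_colIdx (hS : IsRealDiag S σ) (R : Matrix (Fin n₁) (Fin n₁) (Quaternion ℝ))
    (i : Fin n₁) (k : Fin (min n₁ n₂)) :
    (R * S) i (colIdx k) = R i (rowIdx k) * ((σ k : ℝ) : Quaternion ℝ) := by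
  rw [mul_apply, Finset.sum_eq_single (rowIdx k), hS.2]
  · intro a _ ha
    rw [hS.1 a _ fun h => ha (Fin.ext h), mul_zero]
  · simp

lemma row_eq_zero (hS : IsRealDiag S σ) {s : ℕ} (hσ : ∀ k, s ≤ k.val → σ k = 0)
    {i : Fin n₁} (hi : s ≤ i.val) (j : Fin n₂) : S i j = 0 := by
  by_cases hij : i.val = j.val
  · have h := hS.2 ⟨i.val, lt_min i.2 (hij ▸ j.2)⟩
    rwa [hσ _ hi, Quaternion.coe_zero,
      show colIdx ⟨i.val, lt_min i.2 (hij ▸ j.2)⟩ = j from Fin.ext hij] at h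
  · exact hS.1 i j hij

end IsRealDiag

/-- Among weights in `[0, 1]` of total mass at least `m - s`, the cheapest choice puts weight one on
the smallest `m - s` values. The proof compares every term with the threshold value `σ e`, where `e`
is the index `s`. -/
lemma sum_sq_le_weighted_sum {m s : ℕ} {σ w : Fin m → ℝ} (hσ₀ : ∀ k, 0 ≤ σ k) (hσ : Antitone σ)
    (hw₀ : ∀ k, 0 ≤ w k) (hw₁ : ∀ k, w k ≤ 1) (hw : ∑ k, (1 - w k) ≤ s) :
    ∑ k with s ≤ k.val, σ k ^ 2 ≤ ∑ k, w k * σ k ^ 2 := by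
  rcases le_or_gt m s with hms | hsm
  · rw [Finset.sum_eq_zero]
    · exact Finset.sum_nonneg fun k _ => mul_nonneg (hw₀ k) (sq_nonneg _)
    · intro k hk
      have := (Finset.mem_filter.1 hk).2
      omega
  · set e : Fin m := ⟨s, hsm⟩
    have hcard : ∑ k : Fin m, (if s ≤ k.val then (1 : ℝ) else 0) = m - s := by
      have h1 : (Finset.univ.filter fun k : Fin m => s ≤ k.val) = Finset.Ici e := by
        ext k
        simp [e, Fin.le_def]
      rw [Finset.sum_boole, h1, Fin.card_Ici, Nat.cast_sub hsm.le]
    -- Equivalent to `(σ k ^ 2 - σ e ^ 2) * (w k - 1_{s ≤ k}) ≥ 0`: both factors are nonpositive for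
    -- `k ≥ s` and nonnegative for `k < s`.
    have key : ∀ k : Fin m, σ e ^ 2 * (w k - if s ≤ k.val then 1 else 0) ≤
        w k * σ k ^ 2 - if s ≤ k.val then σ k ^ 2 else 0 := by
      intro k
      split_ifs with hk
      · have := pow_le_pow_left₀ (hσ₀ k) (hσ (show e ≤ k from hk)) 2
        nlinarith [hw₁ k]
      · have := pow_le_pow_left₀ (hσ₀ e) (hσ (show k ≤ e from (not_le.1 hk).le)) 2
        nlinarith [hw₀ k]
    have hsum := Finset.sum_le_sum fun k (_ : k ∈ Finset.univ) => key k
    rw [← Finset.mul_sum, Finset.sum_sub_distrib, Finset.sum_sub_distrib, hcard,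
      ← Finset.sum_filter] at hsum
    have hw' : (m : ℝ) - s ≤ ∑ k, w k := by
      rw [Finset.sum_sub_distrib] at hw
      simp only [Finset.sum_const, Finset.card_univ, Fintype.card_fin, nsmul_eq_mul,
        mul_one] at hw
      linarith
    have := mul_nonneg (sq_nonneg (σ e)) (sub_nonneg.2 hw')
    linarith

/-- The tail of the singular values bounds the lower rows of `R * S` for unitary `R`. -/
lemma IsRealDiag.sum_sq_le_lower_rows {S : Matrix (Fin n₁) (Fin n₂) (Quaternion ℝ)}
    {σ : Fin (min n₁ n₂) → ℝ} (hS : IsRealDiag S σ) (hσ₀ : ∀ k, 0 ≤ σ k) (hσ : Antitone σ)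
    {R : Matrix (Fin n₁) (Fin n₁) (Quaternion ℝ)} (hR₁ : Rᴴ * R = 1) (hR₂ : R * Rᴴ = 1) (s : ℕ) :
    ∑ k with s ≤ k.val, σ k ^ 2 ≤ ∑ i with s ≤ i.val, ∑ j, ‖(R * S) i j‖ ^ 2 := by
  have hinj₁ : Function.Injective (rowIdx : Fin (min n₁ n₂) → Fin n₁) := Fin.castLE_injective _
  have hinj₂ : Function.Injective (colIdx : Fin (min n₁ n₂) → Fin n₂) := Fin.castLE_injective _
  have hsub : ∀ k : Fin (min n₁ n₂), 1 - ∑ i with s ≤ i.val, ‖R i (rowIdx k)‖ ^ 2 =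
      ∑ i with ¬ s ≤ i.val, ‖R i (rowIdx k)‖ ^ 2 := by
    intro k
    rw [← sum_col_norm_sq hR₁ (rowIdx k),
      ← Finset.sum_filter_add_sum_filter_not Finset.univ (fun i : Fin n₁ => s ≤ i.val)]
    ring
  -- The weight is the mass of a column of `R` in the rows from `s` on. Columns have norm one, so it
  -- is at most one; the total deficit is mass lying in at most `s` rows of norm one, hence at most
  -- `s`.
  refine (sum_sq_le_weighted_sum (w := fun k => ∑ i with s ≤ i.val, ‖R i (rowIdx k)‖ ^ 2)
    hσ₀ hσ (fun k => by positivity) (fun k => ?_) ?_).trans ?_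
  · have : 0 ≤ ∑ i with ¬ s ≤ i.val, ‖R i (rowIdx k)‖ ^ 2 := by positivity
    linarith [hsub k]
  · simp only [hsub]
    rw [Finset.sum_comm]
    have hrow : ∀ i, ∑ k : Fin (min n₁ n₂), ‖R i (rowIdx k)‖ ^ 2 ≤ 1 := by
      intro i
      rw [← sum_row_norm_sq hR₂ i]
      exact sum_comp_le_sum (f := fun j => ‖R i j‖ ^ 2) hinj₁ (fun j => by positivity)
    refine (Finset.sum_le_sum fun i _ => hrow i).trans ?_
    rw [Finset.sum_const, nsmul_eq_mul, mul_one, Nat.cast_le]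
    calc _ ≤ (Finset.range s).card :=
          Finset.card_le_card_of_injOn Fin.val (by intro i hi; simpa using hi)
            Fin.val_injective.injOn
      _ = s := Finset.card_range s
  · simp only [Finset.sum_mul]
    rw [Finset.sum_comm]
    refine Finset.sum_le_sum fun i _ => ?_
    have h : ∀ k : Fin (min n₁ n₂), ‖R i (rowIdx k)‖ ^ 2 * σ k ^ 2 =
        ‖(R * S) i (colIdx k)‖ ^ 2 := by
      intro k
      rw [hS.mul_apply_colIdx, norm_mul, mul_pow, Quaternion.norm_coe, Real.norm_eq_abs, sq_abs]
    simp only [h]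
    exact sum_comp_le_sum (f := fun j => ‖(R * S) i j‖ ^ 2) hinj₂ (fun j => by positivity)

/-- The Eckart–Young lower bound for quaternion matrices. -/
lemma sum_sq_le_sqNorm_sub {U P : Matrix (Fin n₁) (Fin n₁) (Quaternion ℝ)}
    {V Q : Matrix (Fin n₂) (Fin n₂) (Quaternion ℝ)}
    {S S' : Matrix (Fin n₁) (Fin n₂) (Quaternion ℝ)} {σ : Fin (min n₁ n₂) → ℝ}
    (hU₁ : Uᴴ * U = 1) (hU₂ : U * Uᴴ = 1) (hP₁ : Pᴴ * P = 1) (hP₂ : P * Pᴴ = 1)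
    (hV₁ : Vᴴ * V = 1) (hV₂ : V * Vᴴ = 1)
    (hS : IsRealDiag S σ) (hσ₀ : ∀ k, 0 ≤ σ k) (hσ : Antitone σ) {s : ℕ}
    (hS' : ∀ i j, s ≤ i.val → S' i j = 0) :
    ∑ k with s ≤ k.val, σ k ^ 2 ≤ sqNorm (U * S * Vᴴ - P * S' * Qᴴ) := by
  have hR₁ : (Pᴴ * U)ᴴ * (Pᴴ * U) = 1 := by
    rw [conjTranspose_mul, conjTranspose_conjTranspose, Matrix.mul_assoc, ← Matrix.mul_assoc P,
      hP₂, Matrix.one_mul, hU₁]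
  have hR₂ : (Pᴴ * U) * (Pᴴ * U)ᴴ = 1 := by
    rw [conjTranspose_mul, conjTranspose_conjTranspose, Matrix.mul_assoc, ← Matrix.mul_assoc U,
      hU₂, Matrix.one_mul, hP₁]
  have heq : Pᴴ * (U * S * Vᴴ - P * S' * Qᴴ) * V = Pᴴ * U * S - S' * (Qᴴ * V) := by
    have h1 : Pᴴ * (U * S * Vᴴ) * V = Pᴴ * U * S * (Vᴴ * V) := by simp only [Matrix.mul_assoc]
    have h2 : Pᴴ * (P * S' * Qᴴ) * V = Pᴴ * P * S' * (Qᴴ * V) := by simp only [Matrix.mul_assoc]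
    rw [Matrix.mul_sub, Matrix.sub_mul, h1, h2, hV₁, hP₁, Matrix.mul_one, Matrix.one_mul]
  -- Multiplying by `Pᴴ` and `V` exposes the zero rows of `S'`. They survive any right factor, so
  -- only `Pᴴ * U * S` remains in the rows from `s` on.
  rw [← sqNorm_mul_left (R := Pᴴ) (by simpa using hP₂), ← sqNorm_mul_right hV₂, heq]
  refine (hS.sum_sq_le_lower_rows hσ₀ hσ hR₁ hR₂ s).trans ?_
  calc _ = ∑ i with s ≤ i.val, ∑ j, ‖(Pᴴ * U * S - S' * (Qᴴ * V)) i j‖ ^ 2 := by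
        refine Finset.sum_congr rfl fun i hi => Finset.sum_congr rfl fun j _ => ?_
        rw [Matrix.sub_apply (Pᴴ * U * S), mul_apply (M := S'), Finset.sum_eq_zero, sub_zero]
        intro l _
        rw [hS' i l (Finset.mem_filter.1 hi).2, zero_mul]
    _ ≤ _ := Finset.sum_le_sum_of_subset_of_nonneg (Finset.filter_subset _ _)
        fun _ _ _ => by positivity

end Diagonal

/-! ### Mode products and the transform -/

section Transform

variable {d : ℕ} {N : Fin d → ℕ} {n₁ n₂ p : ℕ}

lemma modeProd_modeProd (i : Fin d) (M M' : Matrix (Fin (N i)) (Fin (N i)) (Quaternion ℝ))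
    (A : QTensor n₁ n₂ N) : modeProd i M (modeProd i M' A) = modeProd i (M * M') A := by
  funext a b n
  simp only [modeProd, Function.update_self, Function.update_idem, mul_apply, Finset.mul_sum,
    Finset.sum_mul, mul_assoc]
  exact Finset.sum_comm

lemma modeProd_one (i : Fin d) (A : QTensor n₁ n₂ N) : modeProd i 1 A = A := by
  funext a b n
  simp [modeProd, one_apply]

lemma modeProd_add (i : Fin d) (M : Matrix (Fin (N i)) (Fin (N i)) (Quaternion ℝ))
    (A B : QTensor n₁ n₂ N) : modeProd i M (A + B) = modeProd i M A + modeProd i M B := by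
  funext a b n
  simp [modeProd, mul_add, Finset.sum_add_distrib]

/-- For fixed `a` and `b`, splitting off the `i`-th index arranges the tube as a matrix `X` on which
the mode product acts as `M * X`; left unitary invariance then applies. -/
lemma sum_norm_sq_modeProd {i : Fin d} {M W : Matrix (Fin (N i)) (Fin (N i)) (Quaternion ℝ)}
    {c : ℝ} (hW : W ∈ unitary (Matrix (Fin (N i)) (Fin (N i)) (Quaternion ℝ))) (hM : M = c • W)
    (A : QTensor n₁ n₂ N) (a : Fin n₁) (b : Fin n₂) :
    ∑ n, ‖modeProd i M A a b n‖ ^ 2 = c ^ 2 * ∑ n, ‖A a b n‖ ^ 2 := by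
  let e := Equiv.piSplitAt i fun j => Fin (N j)
  let X : Matrix (Fin (N i)) ((j : {j // j ≠ i}) → Fin (N j)) (Quaternion ℝ) :=
    Matrix.of fun m y => A a b (e.symm (m, y))
  have hX : ∑ n, ‖A a b n‖ ^ 2 = sqNorm X := by
    rw [← e.symm.sum_comp, Fintype.sum_prod_type]
    rfl
  have hupd : ∀ m m' y, Function.update (e.symm (m, y)) i m' = e.symm (m', y) := by
    intro m m' y
    funext j
    by_cases h : j = i
    · subst h
      simp [e]
    · simp [e, h]
  have hMX : ∑ n, ‖modeProd i M A a b n‖ ^ 2 = sqNorm (M * X) := by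
    rw [← e.symm.sum_comp, Fintype.sum_prod_type, sqNorm]
    refine Finset.sum_congr rfl fun m _ => Finset.sum_congr rfl fun y _ => ?_
    have hm : (e.symm (m, y)) i = m := by simp [e]
    simp only [modeProd, hupd, hm, mul_apply, X, of_apply]
  rw [hMX, hX, hM, Matrix.smul_mul, sqNorm_smul, sqNorm_mul_left hW.1]

variable (T : Transforms N)

lemma transform_add (A B : QTensor n₁ n₂ N) :
    transform T (A + B) = transform T A + transform T B := by
  unfold transform
  induction List.finRange d generalizing A B with
  | nil => rfl
  | cons i l ih => rw [List.foldl_cons, List.foldl_cons, List.foldl_cons, modeProd_add, ih]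

/-- The transform as an additive homomorphism. -/
noncomputable def transformHom : QTensor n₁ n₂ N →+ QTensor n₁ n₂ N :=
  AddMonoidHom.mk' (transform T) (transform_add T)

lemma transform_sub (A B : QTensor n₁ n₂ N) :
    transform T (A - B) = transform T A - transform T B :=
  map_sub (transformHom T) A B

lemma transform_zero : transform T (0 : QTensor n₁ n₂ N) = 0 :=
  map_zero (transformHom T)

lemma transform_sum {ι : Type*} (s : Finset ι) (A : ι → QTensor n₁ n₂ N) :
    transform T (∑ k ∈ s, A k) = ∑ k ∈ s, transform T (A k) :=
  map_sum (transformHom T) A s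

lemma invTransform_transform (A : QTensor n₁ n₂ N) : invTransform T (transform T A) = A := by
  unfold transform invTransform
  induction List.finRange d generalizing A with
  | nil => rfl
  | cons i l ih =>
    rw [List.foldl_cons, List.foldr_cons, ih, modeProd_modeProd, Units.inv_mul, modeProd_one]

lemma transform_invTransform (A : QTensor n₁ n₂ N) : transform T (invTransform T A) = A := by
  unfold transform invTransform
  induction List.finRange d with
  | nil => rfl
  | cons i l ih =>
    rw [List.foldl_cons, List.foldr_cons, modeProd_modeProd, Units.mul_inv, modeProd_one, ih]

lemma transform_injective :
    Function.Injective (transform T : QTensor n₁ n₂ N → QTensor n₁ n₂ N) :=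
  Function.LeftInverse.injective (invTransform_transform T)

/-- The transform acts on each tube separately. -/
lemma transform_congr_tube {m₁ m₂ : ℕ} {A : QTensor n₁ n₂ N} {B : QTensor m₁ m₂ N} {a : Fin n₁}
    {b : Fin n₂} {a' : Fin m₁} {b' : Fin m₂} (h : A a b = B a' b') :
    transform T A a b = transform T B a' b' := by
  unfold transform
  induction List.finRange d generalizing A B with
  | nil => exact h
  | cons i l ih =>
    rw [List.foldl_cons, List.foldl_cons]
    refine ih ?_
    funext n
    simp only [modeProd, h]

lemma transform_apply_eq_zero {A : QTensor n₁ n₂ N} {a : Fin n₁} {b : Fin n₂} (h : A a b = 0) :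
    transform T A a b = 0 := by
  rw [transform_congr_tube T (B := (0 : QTensor n₁ n₂ N)) (a' := a) (b' := b) h, transform_zero]
  rfl

lemma transform_qtProd (A : QTensor n₁ p N) (B : QTensor p n₂ N) :
    transform T (qtProd T A B) = faceProd (transform T A) (transform T B) :=
  transform_invTransform T _

lemma slice_transform_qtProd (A : QTensor n₁ p N) (B : QTensor p n₂ N)
    (n : (i : Fin d) → Fin (N i)) :
    slice (transform T (qtProd T A B)) n = slice (transform T A) n * slice (transform T B) n := by
  rw [transform_qtProd]
  rfl

lemma slice_transform_conjT (A : QTensor n₁ n₂ N) (n : (i : Fin d) → Fin (N i)) :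
    slice (transform T (conjT T A)) n = (slice (transform T A) n)ᴴ := by
  rw [conjT, transform_invTransform]
  rfl

lemma slice_transform_qtProd_conjT {q : ℕ} (U : QTensor n₁ p N) (D : QTensor p q N)
    (V : QTensor n₂ q N) (n : (i : Fin d) → Fin (N i)) :
    slice (transform T (qtProd T (qtProd T U D) (conjT T V))) n =
      slice (transform T U) n * slice (transform T D) n * (slice (transform T V) n)ᴴ := by
  rw [slice_transform_qtProd, slice_transform_qtProd, slice_transform_conjT]

lemma slice_transform_identity (n : (i : Fin d) → Fin (N i)) :
    slice (transform T (identity T p)) n = 1 := by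
  rw [identity, transform_invTransform]
  rfl

lemma IsUnitary.slice_mul {T : Transforms N} {U : QTensor p p N} (hU : IsUnitary T U)
    (n : (i : Fin d) → Fin (N i)) :
    (slice (transform T U) n)ᴴ * slice (transform T U) n = 1 ∧
      slice (transform T U) n * (slice (transform T U) n)ᴴ = 1 := by
  rw [← slice_transform_conjT, ← slice_transform_qtProd, ← slice_transform_qtProd, hU.1, hU.2]
  exact ⟨slice_transform_identity T n, slice_transform_identity T n⟩

/-! ### Frobenius norms -/

lemma frobNorm_nonneg (A : QTensor n₁ n₂ N) : 0 ≤ frobNorm A := Real.sqrt_nonneg _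

lemma frobNorm_sq (A : QTensor n₁ n₂ N) : frobNorm A ^ 2 = ∑ a, ∑ b, ∑ n, ‖A a b n‖ ^ 2 :=
  Real.sq_sqrt (by positivity)

lemma frobNorm_sq_eq_sum_slices (A : QTensor n₁ n₂ N) :
    frobNorm A ^ 2 = ∑ n, sqNorm (slice A n) := by
  rw [frobNorm_sq]
  simp only [sqNorm]
  rw [Finset.sum_comm]
  rw [Finset.sum_comm]
  rw [Finset.sum_comm (s := (Finset.univ : Finset ((i : Fin d) → Fin (N i))))]
  refine Finset.sum_congr rfl fun a _ => ?_
  rw [Finset.sum_comm]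
  rfl

lemma frobNorm_sq_transform {T : Transforms N} {c : (i : Fin d) → ℝ}
    {W : (i : Fin d) → Matrix (Fin (N i)) (Fin (N i)) (Quaternion ℝ)}
    (hW : ∀ i, W i ∈ unitary (Matrix (Fin (N i)) (Fin (N i)) (Quaternion ℝ)))
    (hT : ∀ i, (T i).val = c i • W i) (A : QTensor n₁ n₂ N) :
    frobNorm (transform T A) ^ 2 = (∏ i, c i) ^ 2 * frobNorm A ^ 2 := by
  have h : ∀ l : List (Fin d), frobNorm (l.foldl (fun B i => modeProd i (T i).val B) A) ^ 2 =
      (l.map c).prod ^ 2 * frobNorm A ^ 2 := by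
    intro l
    induction l generalizing A with
    | nil => simp
    | cons i l ih =>
      rw [List.foldl_cons, ih, frobNorm_sq, frobNorm_sq]
      simp only [sum_norm_sq_modeProd (hW i) (hT i), ← Finset.mul_sum, List.map_cons,
        List.prod_cons]
      ring
  rw [transform, h, Fin.prod_univ_def]

end Transform

/-! ### Singular value decompositions of tensors -/

section SVD

variable {d : ℕ} {N : Fin d → ℕ} {n₁ n₂ : ℕ} {T : Transforms N}

/-- A lower set of `Fin m` is an initial segment, hence determined by its size. The bounds come from
`Iic k`, with `k + 1` elements, and `Iio k`, with `k`. -/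
lemma lt_ncard_iff_of_isLowerSet {m : ℕ} {S : Set (Fin m)} (hS : IsLowerSet S) (k : Fin m) :
    k ∈ S ↔ k.val < S.ncard := by
  constructor
  · intro hk
    have h : Set.Iic k ⊆ S := fun j hj => hS hj hk
    have := Set.ncard_le_ncard h (Set.toFinite S)
    rw [← Finset.coe_Iic, Set.ncard_coe_finset, Fin.card_Iic] at this
    omega
  · intro hk
    by_contra hkS
    have h : S ⊆ Set.Iio k := fun j hj => lt_of_not_ge fun hkj => hkS (hS hkj hj)
    have := Set.ncard_le_ncard h (Set.toFinite _)
    rw [← Finset.coe_Iio, Set.ncard_coe_finset, Fin.card_Iio] at this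
    omega

lemma transform_tube (D : QTensor n₁ n₂ N) (k : Fin (min n₁ n₂)) :
    transform T (tube D k) 0 0 = transform T D (rowIdx k) (colIdx k) :=
  transform_congr_tube T rfl

lemma transform_lateral (U : QTensor n₁ n₂ N) (a : Fin n₁) (k : Fin n₂) :
    transform T (lateral U k) a 0 = transform T U a k :=
  transform_congr_tube T rfl

/-- The transform-domain diagonal data of the f-diagonal factor of a TQt-SVD. -/
structure HasSingularValues (T : Transforms N) (D : QTensor n₁ n₂ N)
    (σ : ((i : Fin d) → Fin (N i)) → Fin (min n₁ n₂) → ℝ) : Prop where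
  nonneg : ∀ n k, 0 ≤ σ n k
  antitone : ∀ n, Antitone (σ n)
  isRealDiag : ∀ n, IsRealDiag (slice (transform T D) n) (σ n)

lemma IsTQtSVD.exists_hasSingularValues {A : QTensor n₁ n₂ N} {U : QTensor n₁ n₁ N}
    {D : QTensor n₁ n₂ N} {V : QTensor n₂ n₂ N} (h : IsTQtSVD T A U D V) :
    ∃ σ, HasSingularValues T D σ := by
  obtain ⟨σ, h₀, h₁, h₂⟩ := h.singularValues
  exact ⟨σ, h₀, h₁, fun n => ⟨fun i j hij => congrFun
    (transform_apply_eq_zero T (funext (h.fdiagonal i j hij))) n, h₂ n⟩⟩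

lemma IsTQtSVD.slice_transform {A : QTensor n₁ n₂ N} {U : QTensor n₁ n₁ N}
    {D : QTensor n₁ n₂ N} {V : QTensor n₂ n₂ N} (h : IsTQtSVD T A U D V)
    (n : (i : Fin d) → Fin (N i)) :
    slice (transform T A) n =
      slice (transform T U) n * slice (transform T D) n * (slice (transform T V) n)ᴴ := by
  rw [h.eq_prod, slice_transform_qtProd_conjT]

/-- The tensor `D` with the tubes in the rows from `s` on replaced by zero. -/
noncomputable def truncateRows (D : QTensor n₁ n₂ N) (s : ℕ) : QTensor n₁ n₂ N :=
  fun a b n => if a.val < s then D a b n else 0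

lemma transform_truncateRows (D : QTensor n₁ n₂ N) (s : ℕ) (a : Fin n₁) (b : Fin n₂)
    (n : (i : Fin d) → Fin (N i)) :
    transform T (truncateRows D s) a b n = if a.val < s then transform T D a b n else 0 := by
  split_ifs with h
  · refine congrFun (transform_congr_tube T ?_) n
    funext m
    exact if_pos h
  · refine congrFun (transform_apply_eq_zero T ?_) n
    funext m
    exact if_neg h

/-- Nonnegativity is what keeps the sequence nonincreasing at the jump to zero. -/
lemma HasSingularValues.truncateRows {D : QTensor n₁ n₂ N}
    {σ : ((i : Fin d) → Fin (N i)) → Fin (min n₁ n₂) → ℝ} (h : HasSingularValues T D σ) (s : ℕ) :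
    HasSingularValues T (truncateRows D s) fun n k => if k.val < s then σ n k else 0 where
  nonneg n k := by
    split_ifs
    exacts [h.nonneg n k, le_rfl]
  antitone n k l hkl := by
    have hkl' : k.val ≤ l.val := hkl
    dsimp only
    split_ifs with h₁ h₂
    · exact h.antitone n hkl
    · omega
    · exact h.nonneg n k
    · exact le_rfl
  isRealDiag n := by
    refine ⟨fun i j hij => ?_, fun k => ?_⟩
    · have := (h.isRealDiag n).1 i j hij
      simp only [slice, of_apply] at this
      simp [slice, transform_truncateRows, this]
    · have := (h.isRealDiag n).2 k
      simp only [slice, of_apply] at this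
      simp only [slice, of_apply, transform_truncateRows, this, Fin.val_castLE]
      split_ifs <;> simp

/-- Slicewise, the right side is a double sum that collapses to the diagonal, leaving the rank-one
terms of the truncation. Hence the truncation has a TQt-SVD with the same `U` and `V`. -/
lemma truncation_eq (U : QTensor n₁ n₁ N) {D : QTensor n₁ n₂ N} (hD : IsFDiagonal D)
    (V : QTensor n₂ n₂ N) (s : ℕ) :
    truncation T U D V s = qtProd T (qtProd T U (truncateRows D s)) (conjT T V) := by
  apply transform_injective T
  funext a b n
  have hl : transform T (truncation T U D V s) a b n =
      ∑ k : Fin (min n₁ n₂) with k.val < s, transform T U a (rowIdx k) n *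
        transform T D (rowIdx k) (colIdx k) n * star (transform T V b (colIdx k) n) := by
    rw [truncation, transform_sum, Finset.sum_apply, Finset.sum_apply, Finset.sum_apply]
    refine Finset.sum_congr rfl fun k _ => ?_
    have := congrFun (congrFun (slice_transform_qtProd_conjT T (lateral U (rowIdx k)) (tube D k)
      (lateral V (colIdx k)) n) a) b
    simpa [slice, mul_apply, transform_tube, transform_lateral] using this
  have hr : transform T (qtProd T (qtProd T U (truncateRows D s)) (conjT T V)) a b n =
      ∑ i, ∑ j, transform T U a i n * transform T (truncateRows D s) i j n *
        star (transform T V b j n) := by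
    have := congrFun (congrFun (slice_transform_qtProd_conjT T U (truncateRows D s) V n) a) b
    rw [Finset.sum_comm]
    simpa [slice, mul_apply, Finset.sum_mul] using this
  rw [hl, hr, sum_sum_eq_sum_diag, Finset.sum_filter]
  · refine Finset.sum_congr rfl fun k _ => ?_
    rw [transform_truncateRows, Fin.val_castLE]
    split_ifs <;> simp
  · intro i j hij
    rw [transform_truncateRows, transform_apply_eq_zero T (funext (hD i j hij))]
    simp

lemma IsTQtSVD.truncation {A : QTensor n₁ n₂ N} {U : QTensor n₁ n₁ N}
    {D : QTensor n₁ n₂ N} {V : QTensor n₂ n₂ N} (h : IsTQtSVD T A U D V) (s : ℕ) :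
    IsTQtSVD T (truncation T U D V s) U (truncateRows D s) V where
  unitary_left := h.unitary_left
  unitary_right := h.unitary_right
  fdiagonal a b hab n := by simp [truncateRows, h.fdiagonal a b hab n]
  singularValues := by
    obtain ⟨σ, hσ⟩ := h.exists_hasSingularValues
    have h' := hσ.truncateRows s
    exact ⟨_, h'.nonneg, h'.antitone, fun n k => (h'.isRealDiag n).2 k⟩
  eq_prod := truncation_eq U h.fdiagonal V s

variable {c : (i : Fin d) → ℝ} {W : (i : Fin d) → Matrix (Fin (N i)) (Fin (N i)) (Quaternion ℝ)}

lemma HasSingularValues.frobNorm_sq_tube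
    (hW : ∀ i, W i ∈ unitary (Matrix (Fin (N i)) (Fin (N i)) (Quaternion ℝ)))
    (hT : ∀ i, (T i).val = c i • W i) {D : QTensor n₁ n₂ N}
    {σ : ((i : Fin d) → Fin (N i)) → Fin (min n₁ n₂) → ℝ} (h : HasSingularValues T D σ)
    (k : Fin (min n₁ n₂)) :
    (∏ i, c i) ^ 2 * frobNorm (tube D k) ^ 2 = ∑ n, σ n k ^ 2 := by
  rw [← frobNorm_sq_transform hW hT, frobNorm_sq]
  simp only [Finset.univ_unique, Finset.sum_singleton, Fin.default_eq_zero, transform_tube]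
  refine Finset.sum_congr rfl fun n _ => ?_
  have := (h.isRealDiag n).2 k
  simp only [slice, of_apply] at this
  rw [this, Quaternion.norm_coe, Real.norm_eq_abs, sq_abs]

lemma frobNorm_tube_pos_iff {D : QTensor n₁ n₂ N} {k : Fin (min n₁ n₂)} :
    0 < frobNorm (tube D k) ↔ D (rowIdx k) (colIdx k) ≠ 0 := by
  rw [(frobNorm_nonneg _).lt_iff_ne', ← pow_ne_zero_iff two_ne_zero, frobNorm_sq]
  simp [Finset.sum_eq_zero_iff_of_nonneg, tube, funext_iff]

lemma HasSingularValues.frobNorm_tube_pos_iff {D : QTensor n₁ n₂ N}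
    {σ : ((i : Fin d) → Fin (N i)) → Fin (min n₁ n₂) → ℝ} (h : HasSingularValues T D σ)
    {k : Fin (min n₁ n₂)} : 0 < frobNorm (tube D k) ↔ ∃ n, 0 < σ n k := by
  have hσ : ∀ n, transform T D (rowIdx k) (colIdx k) n = ((σ n k : ℝ) : Quaternion ℝ) :=
    fun n => (h.isRealDiag n).2 k
  rw [QuatTensor.frobNorm_tube_pos_iff, ← not_iff_not, not_not]
  push Not
  constructor
  · intro h0 n
    have := hσ n
    rw [transform_apply_eq_zero T h0] at this
    exact (Quaternion.coe_injective this).ge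
  · intro h0
    have h1 : transform T D (rowIdx k) (colIdx k) = 0 := by
      funext n
      rw [hσ n, le_antisymm (h0 n) (h.nonneg n k)]
      rfl
    have h2 := transform_tube (T := T) D k
    rw [h1] at h2
    have h3 : tube D k = 0 := by
      -- Injectivity on `1 × 1` tensors brings the vanishing of the transformed tube back to the
      -- tube itself.
      apply transform_injective T
      funext a b
      rw [Subsingleton.elim a 0, Subsingleton.elim b 0, h2, transform_zero]
      rfl
    exact congrFun (congrFun h3 0) 0

/-- The nonzero tubes are the leading ones. -/
lemma HasSingularValues.tube_pos_iff_lt {D : QTensor n₁ n₂ N}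
    {σ : ((i : Fin d) → Fin (N i)) → Fin (min n₁ n₂) → ℝ} (h : HasSingularValues T D σ)
    (k : Fin (min n₁ n₂)) : (∃ n, 0 < σ n k) ↔ k.val < numNonzeroTubes D := by
  rw [numNonzeroTubes, ← lt_ncard_iff_of_isLowerSet, Set.mem_ofPred_eq, h.frobNorm_tube_pos_iff]
  intro k l hlk hk
  rw [Set.mem_ofPred_eq, h.frobNorm_tube_pos_iff] at hk ⊢
  obtain ⟨n, hn⟩ := hk
  exact ⟨n, hn.trans_le (h.antitone n hlk)⟩

lemma HasSingularValues.eq_zero {D : QTensor n₁ n₂ N}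
    {σ : ((i : Fin d) → Fin (N i)) → Fin (min n₁ n₂) → ℝ} (h : HasSingularValues T D σ)
    (n : (i : Fin d) → Fin (N i)) {k : Fin (min n₁ n₂)} (hk : numNonzeroTubes D ≤ k.val) :
    σ n k = 0 := by
  refine le_antisymm (not_lt.1 fun hn => ?_) (h.nonneg n k)
  exact absurd ((h.tube_pos_iff_lt k).1 ⟨n, hn⟩) (by omega)

lemma numNonzeroTubes_le (D : QTensor n₁ n₂ N) : numNonzeroTubes D ≤ min n₁ n₂ := by
  rw [numNonzeroTubes]
  exact (Set.ncard_le_card _).trans_eq (Nat.card_fin _)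

lemma numNonzeroTubes_truncateRows {D : QTensor n₁ n₂ N}
    {σ : ((i : Fin d) → Fin (N i)) → Fin (min n₁ n₂) → ℝ} (h : HasSingularValues T D σ) {s : ℕ}
    (hs : s ≤ numNonzeroTubes D) : numNonzeroTubes (truncateRows D s) = s := by
  have hmin := numNonzeroTubes_le D
  have hset : {k : Fin (min n₁ n₂) | 0 < frobNorm (tube (truncateRows D s) k)} =
      {k | k.val < s} := by
    ext k
    rw [Set.mem_ofPred_eq, Set.mem_ofPred_eq, (h.truncateRows s).frobNorm_tube_pos_iff]
    split_ifs with hk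
    · exact iff_of_true ((h.tube_pos_iff_lt k).2 (hk.trans_le hs)) hk
    · simp [hk]
  rw [numNonzeroTubes, hset, ← Set.ncard_image_of_injective _ Fin.val_injective]
  have : Fin.val '' {k : Fin (min n₁ n₂) | k.val < s} = (Finset.range s : Set ℕ) := by
    ext j
    simp only [Set.mem_image, Set.mem_ofPred_eq, Finset.coe_range, Set.mem_Iio]
    exact ⟨by rintro ⟨k, hk, rfl⟩; exact hk, fun hj => ⟨⟨j, by omega⟩, hj, rfl⟩⟩
  rw [this, Set.ncard_coe_finset, Finset.card_range]

/-- In each slice, the tail of the singular values of `A` bounds the transform-domain distance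
to any tensor with few nonzero tubes. -/
lemma IsTQtSVD.sum_sq_le_sqNorm_slice {A G : QTensor n₁ n₂ N} {U P : QTensor n₁ n₁ N}
    {D E : QTensor n₁ n₂ N} {V Q : QTensor n₂ n₂ N} (hA : IsTQtSVD T A U D V)
    (hG : IsTQtSVD T G P E Q) {σ : ((i : Fin d) → Fin (N i)) → Fin (min n₁ n₂) → ℝ}
    (hσ : HasSingularValues T D σ) (n : (i : Fin d) → Fin (N i)) :
    ∑ k with numNonzeroTubes E ≤ k.val, σ n k ^ 2 ≤ sqNorm (slice (transform T (A - G)) n) := by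
  obtain ⟨τ, hτ⟩ := hG.exists_hasSingularValues
  obtain ⟨hU₁, hU₂⟩ := hA.unitary_left.slice_mul n
  obtain ⟨hV₁, hV₂⟩ := hA.unitary_right.slice_mul n
  obtain ⟨hP₁, hP₂⟩ := hG.unitary_left.slice_mul n
  have hsub : slice (transform T (A - G)) n = slice (transform T A) n - slice (transform T G) n := by
    rw [transform_sub]
    rfl
  rw [hsub, hA.slice_transform, hG.slice_transform]
  exact sum_sq_le_sqNorm_sub hU₁ hU₂ hP₁ hP₂ hV₁ hV₂ (hσ.isRealDiag n) (hσ.nonneg n)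
    (hσ.antitone n) fun i j hi =>
      (hτ.isRealDiag n).row_eq_zero (fun k hk => hτ.eq_zero n hk) hi j

lemma IsTQtSVD.numNonzeroTubes_le {A : QTensor n₁ n₂ N} {U P : QTensor n₁ n₁ N}
    {D E : QTensor n₁ n₂ N} {V Q : QTensor n₂ n₂ N} (h : IsTQtSVD T A U D V)
    (h' : IsTQtSVD T A P E Q) : numNonzeroTubes D ≤ numNonzeroTubes E := by
  obtain ⟨σ, hσ⟩ := h.exists_hasSingularValues
  by_contra! hlt
  -- With indices from zero, `numNonzeroTubes E` is the first index of the tail, yet still that of a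
  -- nonzero tube of `D`; its positive singular value contradicts the zero distance from `A` to `A`.
  obtain ⟨n, hn⟩ := (hσ.tube_pos_iff_lt
    ⟨numNonzeroTubes E, hlt.trans_le (QuatTensor.numNonzeroTubes_le D)⟩).2 hlt
  have hle := h.sum_sq_le_sqNorm_slice h' hσ n
  have h0 : sqNorm (slice (transform T (A - A)) n) = 0 := by
    rw [sub_self, transform_zero]
    simp [sqNorm, slice]
  have hpos : 0 < ∑ k with numNonzeroTubes E ≤ k.val, σ n k ^ 2 :=
    (pow_pos hn 2).trans_le (Finset.single_le_sum (f := fun k => σ n k ^ 2)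
      (fun _ _ => sq_nonneg _) (by simp))
  linarith

lemma IsTQtSVD.numNonzeroTubes_eq {A : QTensor n₁ n₂ N} {U : QTensor n₁ n₁ N}
    {D : QTensor n₁ n₂ N} {V : QTensor n₂ n₂ N} (h : IsTQtSVD T A U D V) {r : ℕ}
    (hr : HasTQtRank T A r) : numNonzeroTubes D = r := by
  obtain ⟨P, E, Q, h', rfl⟩ := hr
  exact le_antisymm (h.numNonzeroTubes_le h') (h'.numNonzeroTubes_le h)

lemma IsTQtSVD.sqNorm_slice_sub_truncation {A : QTensor n₁ n₂ N} {U : QTensor n₁ n₁ N}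
    {D : QTensor n₁ n₂ N} {V : QTensor n₂ n₂ N} (h : IsTQtSVD T A U D V)
    {σ : ((i : Fin d) → Fin (N i)) → Fin (min n₁ n₂) → ℝ} (hσ : HasSingularValues T D σ) (s : ℕ)
    (n : (i : Fin d) → Fin (N i)) :
    sqNorm (slice (transform T (A - QuatTensor.truncation T U D V s)) n) =
      ∑ k with s ≤ k.val, σ n k ^ 2 := by
  obtain ⟨hU, -⟩ := h.unitary_left.slice_mul n
  obtain ⟨hV, -⟩ := h.unitary_right.slice_mul n
  have hsub : slice (transform T (A - QuatTensor.truncation T U D V s)) n =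
      slice (transform T U) n * (slice (transform T D) n -
        slice (transform T (QuatTensor.truncateRows D s)) n) * (slice (transform T V) n)ᴴ := by
    rw [Matrix.mul_sub, Matrix.sub_mul, ← h.slice_transform, ← (h.truncation s).slice_transform,
      transform_sub]
    rfl
  have hdiag : IsRealDiag (slice (transform T D) n -
      slice (transform T (QuatTensor.truncateRows D s)) n)
      fun k => σ n k - if k.val < s then σ n k else 0 := by
    have h₁ := hσ.isRealDiag n
    have h₂ := (hσ.truncateRows s).isRealDiag n
    refine ⟨fun i j hij => ?_, fun k => ?_⟩
    · rw [Matrix.sub_apply, h₁.1 i j hij, h₂.1 i j hij, sub_zero]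
    · rw [Matrix.sub_apply, h₁.2, h₂.2, Quaternion.coe_sub]
  rw [hsub, sqNorm_mul_right (by simpa using hV), sqNorm_mul_left hU, hdiag.sqNorm_eq,
    Finset.sum_filter]
  refine Finset.sum_congr rfl fun k _ => ?_
  by_cases hk : k.val < s
  · simp [hk, not_le.2 hk]
  · simp [hk, not_lt.1 hk]

end SVD

end QuatTensor

theorem theorem2 {d : ℕ} {N : Fin d → ℕ} {n₁ n₂ : ℕ}
    (T : Transforms N) (c : (i : Fin d) → ℝ)
    (W : (i : Fin d) → Matrix (Fin (N i)) (Fin (N i)) (Quaternion ℝ))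
    (hc : ∀ i, c i ≠ 0)
    (hW : ∀ i, W i ∈ unitary (Matrix (Fin (N i)) (Fin (N i)) (Quaternion ℝ)))
    (hT : ∀ i, (T i).val = c i • W i)
    (A : QTensor n₁ n₂ N)
    (U : QTensor n₁ n₁ N) (D : QTensor n₁ n₂ N) (V : QTensor n₂ n₂ N)
    (hA : IsTQtSVD T A U D V)
    (r s : ℕ) (hr : HasTQtRank T A r) (hs : s ≤ r) :
    HasTQtRank T (truncation T U D V s) s ∧
    (∀ G : QTensor n₁ n₂ N, HasTQtRank T G s →
      frobNorm (A - truncation T U D V s) ≤ frobNorm (A - G)) ∧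
    frobNorm (A - truncation T U D V s) ^ 2 =
      ∑ k : Fin (min n₁ n₂) with s ≤ k.val ∧ k.val < r, frobNorm (tube D k) ^ 2 := by
  obtain ⟨σ, hσ⟩ := hA.exists_hasSingularValues
  have hDr := hA.numNonzeroTubes_eq hr
  have hC : 0 < (∏ i, c i) ^ 2 := by
    have := Finset.prod_ne_zero_iff.2 fun i (_ : i ∈ Finset.univ) => hc i
    positivity
  have herr : (∏ i, c i) ^ 2 * frobNorm (A - truncation T U D V s) ^ 2 =
      ∑ n, ∑ k with s ≤ k.val, σ n k ^ 2 := by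
    rw [← frobNorm_sq_transform hW hT, frobNorm_sq_eq_sum_slices]
    exact Finset.sum_congr rfl fun n _ => hA.sqNorm_slice_sub_truncation hσ s n
  refine ⟨⟨U, _, V, hA.truncation s, numNonzeroTubes_truncateRows hσ (hs.trans_eq hDr.symm)⟩,
    ?_, ?_⟩
  · rintro G ⟨P, E, Q, hG, rfl⟩
    rw [← sq_le_sq₀ (frobNorm_nonneg _) (frobNorm_nonneg _), ← mul_le_mul_iff_right₀ hC, herr,
      ← frobNorm_sq_transform hW hT, frobNorm_sq_eq_sum_slices]
    exact Finset.sum_le_sum fun n _ => hA.sum_sq_le_sqNorm_slice hG hσ n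
  · apply mul_left_cancel₀ hC.ne'
    rw [herr, Finset.mul_sum, Finset.sum_comm]
    simp only [hσ.frobNorm_sq_tube hW hT]
    symm
    -- The slicewise error runs over all `k ≥ s`; the terms with `k ≥ r` vanish.
    refine Finset.sum_subset (fun k => by simp +contextual) fun k hk hk' => ?_
    have hk₁ : s ≤ k.val := by simpa using hk
    have hk₂ : r ≤ k.val := by simpa [hk₁] using hk'
    exact Finset.sum_eq_zero fun n _ => by rw [hσ.eq_zero n (hDr.trans_le hk₂), sq, mul_zero]
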